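/- Let $n\ge 0$, let $H\subset\mathbf{RP}^n$ be a finite set of points (lines through $0$ in $\mathbf R^{n+1}$) with $|H|=T$, let $w\in H$, and let $\mathbf F$ be an arbitrary field. For a set $S$ of points write $\operatorname{span} S\subset\mathbf R^{n+1}$ for the linear subspace generated by the corresponding lines. Let $K^H$ be the simplicial complex whose simplices are the nonempty subsets $S\subset H$ with $\operatorname{span} S\neq\mathbf R^{n+1}$, and let $K^H_{n-1}$ be its $(n-1)$-skeleton. For $s\ge 1$ let $\langle H;w\notin\rangle^{\times s}_{\neq 0}$ be the set of ordered $s$-tuples $U=(u_s,\dots,u_1)$ of distinct points of $H$ with $\dim\operatorname{span}U=s$ and $w\not\subset\operatorname{span}U$. For such $U$ and $1\le l\le s$ let $q^U_l$ be the number of points of $H$ contained in $\operatorname{span}(u_l,\dots,u_1)$, the span of the last $l$ entries. For an $s$-tuple $U$ with $s\ge2$ put $$A_s(U;d)=\left[\binom{T-q^U_{s-1}-2}{q^U_s-q^U_{s-1}-1}-\binom{T-q^U_{s-1}-d}{q^U_s-q^U_{s-1}-1}\right](q^U_s-q^U_{s-1}-1)!.$$ Let $D_n(H;w)$ be the number of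 $n$-element subsets $S\subset H\setminus\{w\}$ such that $S\cup\{w\}$ is linearly dependent, i.e. $\dim\operatorname{span}(S\cup\{w\})<n+1$. Then $$\operatorname{rank}H_n\left(K^H,K^H_{n-1};\mathbf F\right)\le\frac1{(T-1)!}\sum_{k=0}^{n-2}\ \sum_{U\in\langle H;w\notin\rangle^{\times(n-k)}_{\neq0}}\frac1{q^U_{n-k-1}\cdots q^U_1}\sum_{d=k+3}^{T-q^U_{n-k-1}}\frac{(T-d)!\,(T-q^U_{n-k}-1)!}{(T-q^U_{n-k-1}-d)!}\,A_{n-k}(U;d)\binom{d-2}{k}+D_n(H;w),$$ where the sum over $k$ is empty if $n\le1$. -/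

import Mathlib

/-! ### Relative simplicial homology with coefficients in a field -/

namespace SimplicialHomology

variable {ι : Type*}

/-- The subcomplex of all simplices of dimension `< m` (that is, with at most `m` vertices): the
`(m - 1)`-skeleton of `K`. -/
def skeletonLT (K : PreAbstractSimplicialComplex ι) (m : ℕ) : PreAbstractSimplicialComplex ι where
  faces := {s | s ∈ K.faces ∧ s.card ≤ m}
  isRelLowerSet_faces := fun {_} hs =>
    ⟨(K.isRelLowerSet_faces hs.1).1, fun _ hts ht =>
      ⟨(K.isRelLowerSet_faces hs.1).2 hts ht, (Finset.card_le_card hts).trans hs.2⟩⟩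

/-- The simplicial `m`-chains of `K`: formal combinations of the simplices with `m + 1` vertices. -/
def chains (F : Type*) [Field F] (K : PreAbstractSimplicialComplex ι) (m : ℕ) :
    Submodule F (Finset ι →₀ F) :=
  Finsupp.supported F F {s | s ∈ K.faces ∧ s.card = m + 1}

/-- The simplicial boundary operator, the simplices being oriented by a linear order of the
vertices: `∂{v₀ < ⋯ < vₘ} = ∑ i, (-1)ⁱ {v₀, …, vₘ} \ {vᵢ}`. It is used for `m ≥ 1` only. -/
noncomputable def boundary (F : Type*) [Field F] [LinearOrder ι] :
    (Finset ι →₀ F) →ₗ[F] (Finset ι →₀ F) :=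
  Finsupp.linearCombination F fun s : Finset ι =>
    ∑ v ∈ s, Finsupp.single (s.erase v) ((-1 : F) ^ (s.filter (· < v)).card)

/-- Relative `m`-cycles of `(K, L)`: the `m`-chains of `K` whose boundary is a chain of `L`; every
`0`-chain is a cycle. -/
noncomputable def relCycles (F : Type*) [Field F] [LinearOrder ι]
    (K L : PreAbstractSimplicialComplex ι) : ℕ → Submodule F (Finset ι →₀ F)
  | 0 => chains F K 0
  | m + 1 => chains F K (m + 1) ⊓ (chains F L m).comap (boundary F)

/-- Relative `m`-boundaries of `(K, L)`: boundaries of chains of `K`, plus chains of `L`. -/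
noncomputable def relBoundaries (F : Type*) [Field F] [LinearOrder ι]
    (K L : PreAbstractSimplicialComplex ι) (m : ℕ) : Submodule F (Finset ι →₀ F) :=
  (chains F K (m + 1)).map (boundary F) ⊔ chains F L m

/-- The quotient of a subspace `Z` by a subspace `B` of `Z`. -/
abbrev Subquotient {F V : Type*} [Field F] [AddCommGroup V] [Module F V] (Z B : Submodule F V) :
    Type _ :=
  Z ⧸ B.submoduleOf Z

/-- The relative simplicial homology `Hₘ(K, L; F)`, for a subcomplex `L` of `K`. -/
abbrev RelHomology (F : Type*) [Field F] [LinearOrder ι]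
    (K L : PreAbstractSimplicialComplex ι) (m : ℕ) : Type _ :=
  Subquotient (relCycles F K L m) (relBoundaries F K L m)

end SimplicialHomology

/-! ### Finite sets of points in real projective space -/

namespace ProjArrangement

/-- The real projective space of dimension `n`: the lines of `ℝⁿ⁺¹`. -/
abbrev RP (n : ℕ) : Type := Projectivization ℝ (Fin (n + 1) → ℝ)

variable {n : ℕ}

/-- The linear subspace of `ℝⁿ⁺¹` spanned by a set of points of projective space. -/
noncomputable def linSpan (S : Set (RP n)) : Submodule ℝ (Fin (n + 1) → ℝ) :=
  ⨆ p ∈ S, p.submodule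

theorem linSpan_mono {S S' : Set (RP n)} (h : S ⊆ S') : linSpan S ≤ linSpan S' :=
  biSup_mono fun _ hp => h hp

/-- The complex `K^H`: its simplices are the nonempty subsets of `H` that do not span `ℝⁿ⁺¹`. -/
def KComplex (H : Finset (RP n)) : PreAbstractSimplicialComplex (RP n) where
  faces := {s | s.Nonempty ∧ s ⊆ H ∧ linSpan (s : Set (RP n)) ≠ ⊤}
  isRelLowerSet_faces := fun {_} hs =>
    ⟨hs.1, fun _ hts ht => ⟨ht, hts.trans hs.2.1, fun htop =>
      hs.2.2 (top_le_iff.mp (htop ▸ linSpan_mono (Finset.coe_subset.mpr hts)))⟩⟩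

open Classical in
/-- The ordered `s`-tuples of distinct, linearly independent points of `H` whose span does not
contain `w`. -/
noncomputable def indepTuplesAvoiding (H : Finset (RP n)) (w : RP n) (s : ℕ) :
    Finset (Fin s → RP n) :=
  (Fintype.piFinset fun _ => H).filter fun U =>
    Function.Injective U ∧ Module.finrank ℝ (linSpan (Set.range U)) = s ∧
      ¬ w.submodule ≤ linSpan (Set.range U)

open Classical in
/-- The entry `q_l^U` of the combinatorial flag of `U`: the number of points of `H` in the span of
the last `l` entries of the tuple `U`. -/
noncomputable def flagCount (H : Finset (RP n)) {s : ℕ} (U : Fin s → RP n) (l : ℕ) : ℕ :=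
  (H.filter fun p => p.submodule ≤ linSpan (U '' {j | s ≤ (j : ℕ) + l})).card

/-- The quantity `A_s(U; d)`, for an `s`-tuple `U`, where `T = |H|`. -/
noncomputable def coeffA (H : Finset (RP n)) {s : ℕ} (U : Fin s → RP n) (d : ℕ) : ℝ :=
  (((H.card - flagCount H U (s - 1) - 2).choose
        (flagCount H U s - flagCount H U (s - 1) - 1) : ℝ) -
      ((H.card - flagCount H U (s - 1) - d).choose
        (flagCount H U s - flagCount H U (s - 1) - 1) : ℝ)) *
    ((flagCount H U s - flagCount H U (s - 1) - 1).factorial : ℝ)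

open Classical in
/-- `D_n(H; w)`: the number of `n`-element subsets of `H \ {w}` that become linearly dependent
together with `w`. -/
noncomputable def numDependent (H : Finset (RP n)) (w : RP n) : ℕ :=
  ((H.powersetCard n).filter fun S => w ∉ S ∧
    Module.finrank ℝ (linSpan (insert w (S : Set (RP n)))) < n + 1).card

end ProjArrangement

/-! Order `H` injectively. An element `x` of `S ⊆ H` is broken if the elements of `S` from `x` on
span a point of `H` earlier than `x`; let `m S` be the earliest point of `H` in that span for the
last broken `x`. A set without broken elements is independent, so every `n`-simplex `Q` of `K^H`,
being a nonspanning set of `n + 1` points, has a broken element. If `m Q ∉ Q`, adding `m Q` does not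
enlarge the span, so the boundary of `Q ∪ {m Q}` rewrites `Q` through simplices that contain `m Q`
as their own earliest point or have a smaller sum of positions. Modulo boundaries this leaves the
simplices `S ∪ {m S}`. If such a simplex does not span everything together with `w`, coning from `w`
rewrites it through simplices containing `w`, which `D_n(H; w)` counts. Otherwise `S` is a broken
set completed to a basis by `w`. This gives `finrank_relHomology_le` for every ordering.

When `w` comes first, a broken set consists of `k` elements before its last broken element `u_s`,
where `s = n - k`, and of an independent tuple `(u_s, …, u_1)` in increasing order: each `u_l` with
`l < s` is first in its flag step, while `u_s` precedes step `s - 1` but is not first in step `s`.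
Averaging over the `(T - 1)!` orderings starting with `w` turns the bound into the probability of
such flags: `u_s` in position `d` and broken gives `A_s(U; d)`, the conditions on the lower steps
give `1 / (q_{s-1} ⋯ q_1)`, and the choices of the other `k` elements give `choose (d - 2) k`. -/

namespace ProjArrangement

variable {n : ℕ}

/-! ### Spans and independence of sets of points -/

theorem submodule_le_linSpan {S : Set (RP n)} {p : RP n} (hp : p ∈ S) :
    p.submodule ≤ linSpan S :=
  le_biSup (fun q : RP n => q.submodule) hp

theorem linSpan_le_iff {S : Set (RP n)} {W : Submodule ℝ (Fin (n + 1) → ℝ)} :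
    linSpan S ≤ W ↔ ∀ p ∈ S, p.submodule ≤ W :=
  iSup₂_le_iff

theorem linSpan_insert (p : RP n) (S : Set (RP n)) :
    linSpan (insert p S) = p.submodule ⊔ linSpan S :=
  iSup_insert

theorem linSpan_insert_of_le {p : RP n} {S : Set (RP n)} (h : p.submodule ≤ linSpan S) :
    linSpan (insert p S) = linSpan S := by
  rw [linSpan_insert, sup_eq_right.mpr h]

theorem linSpan_empty : linSpan (∅ : Set (RP n)) = ⊥ := by
  simp [linSpan]

theorem not_submodule_le_bot (p : RP n) : ¬ p.submodule ≤ ⊥ := by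
  intro h
  have := p.finrank_submodule
  rw [le_bot_iff.mp h, finrank_bot] at this
  exact zero_ne_one this

theorem eq_of_submodule_le {p q : RP n} (h : p.submodule ≤ q.submodule) : p = q :=
  Projectivization.submodule_injective
    (Submodule.eq_of_le_of_finrank_eq h (by rw [p.finrank_submodule, q.finrank_submodule]))

theorem finrank_linSpan_insert_le (p : RP n) (S : Set (RP n)) :
    Module.finrank ℝ (linSpan (insert p S)) ≤ Module.finrank ℝ (linSpan S) + 1 := by
  rw [linSpan_insert]
  refine (Submodule.finrank_add_le_finrank_add_finrank _ _).trans_eq ?_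
  rw [p.finrank_submodule, add_comm 1]

theorem finrank_linSpan_insert {p : RP n} {S : Set (RP n)} (h : ¬ p.submodule ≤ linSpan S) :
    Module.finrank ℝ (linSpan (insert p S)) = Module.finrank ℝ (linSpan S) + 1 := by
  refine le_antisymm (finrank_linSpan_insert_le p S) ?_
  refine Submodule.finrank_lt_finrank_of_lt
    (lt_of_le_of_ne (linSpan_mono (Set.subset_insert p S)) fun he => h ?_)
  rw [he]
  exact submodule_le_linSpan (Set.mem_insert p S)

theorem finrank_linSpan_le_card (S : Finset (RP n)) :
    Module.finrank ℝ (linSpan (S : Set (RP n))) ≤ S.card := by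
  classical
  induction S using Finset.induction_on with
  | empty => simp [linSpan_empty]
  | insert p S hp ih =>
    rw [Finset.coe_insert, Finset.card_insert_of_notMem hp]
    exact (finrank_linSpan_insert_le p _).trans (by omega)

theorem linSpan_eq_top_iff {S : Set (RP n)} :
    linSpan S = ⊤ ↔ Module.finrank ℝ (linSpan S) = n + 1 := by
  constructor
  · intro h
    rw [h, finrank_top, Module.finrank_fin_fun]
  · intro h
    exact Submodule.eq_top_of_finrank_eq (by rw [h, Module.finrank_fin_fun])

/-- Each point of `S \ S'` raises the dimension by at most one, so a deficit in `S'` would persist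
in `S`. -/
theorem finrank_linSpan_eq_card_of_subset {S S' : Finset (RP n)} (hsub : S' ⊆ S)
    (hS : Module.finrank ℝ (linSpan (S : Set (RP n))) = S.card) :
    Module.finrank ℝ (linSpan (S' : Set (RP n))) = S'.card := by
  classical
  suffices h : ∀ R : Finset (RP n), Module.finrank ℝ (linSpan ((S' ∪ R : Finset (RP n)) : Set (RP n)))
      ≤ Module.finrank ℝ (linSpan (S' : Set (RP n))) + R.card by
    have h1 := h (S \ S')
    rw [Finset.union_sdiff_of_subset hsub, hS, Finset.card_sdiff_of_subset hsub] at h1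
    have h2 := finrank_linSpan_le_card S'
    have h3 := Finset.card_le_card hsub
    omega
  intro R
  induction R using Finset.induction_on with
  | empty => rw [Finset.union_empty]; exact Nat.le_add_right _ _
  | insert p R hp ih =>
    rw [Finset.union_insert, Finset.coe_insert, Finset.card_insert_of_notMem hp]
    exact (finrank_linSpan_insert_le p _).trans (by omega)

theorem not_submodule_le_linSpan_of_notMem {S S' : Finset (RP n)} {x : RP n}
    (hS : Module.finrank ℝ (linSpan (S : Set (RP n))) = S.card) (hsub : S' ⊆ S) (hx : x ∈ S)
    (hxS' : x ∉ S') : ¬ x.submodule ≤ linSpan (S' : Set (RP n)) := by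
  classical
  intro h
  have h1 := finrank_linSpan_eq_card_of_subset
    (Finset.insert_subset_iff.mpr ⟨hx, hsub⟩) hS
  rw [Finset.coe_insert, linSpan_insert_of_le h, Finset.card_insert_of_notMem hxS'] at h1
  have := finrank_linSpan_le_card S'
  omega

end ProjArrangement

/-! ### Generating relative homology modulo boundaries -/

namespace SimplicialHomology

variable {ι : Type*}

theorem boundary_single {F : Type*} [Field F] [LinearOrder ι] (s : Finset ι) :
    boundary F (Finsupp.single s 1) =
      ∑ v ∈ s, Finsupp.single (s.erase v) ((-1 : F) ^ (s.filter (· < v)).card) := by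
  simp [boundary]

theorem relCycles_le_chains {F : Type*} [Field F] [LinearOrder ι]
    (K L : PreAbstractSimplicialComplex ι) (m : ℕ) : relCycles F K L m ≤ chains F K m := by
  cases m with
  | zero => exact le_rfl
  | succ m => exact inf_le_left

/-- A face of a simplex of `K` is congruent modulo boundaries to a combination of the other faces. -/
theorem single_mem_of_erase_mem {F : Type*} [Field F] [LinearOrder ι]
    {K L : PreAbstractSimplicialComplex ι} {m : ℕ} {M : Submodule F (Finset ι →₀ F)}
    (hM : relBoundaries F K L m ≤ M) {s : Finset ι} {v : ι} (hv : v ∉ s)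
    (hface : insert v s ∈ K.faces) (hcard : s.card = m + 1)
    (h : ∀ u ∈ s, Finsupp.single ((insert v s).erase u) (1 : F) ∈ M) :
    Finsupp.single s (1 : F) ∈ M := by
  have hb : boundary F (Finsupp.single (insert v s) 1) ∈ M := by
    refine hM (Submodule.mem_sup_left (Submodule.mem_map_of_mem ?_))
    refine Finsupp.single_mem_supported F _ ⟨hface, ?_⟩
    rw [Finset.card_insert_of_notMem hv, hcard]
  rw [boundary_single, Finset.sum_insert hv, Finset.erase_insert hv] at hb
  have hs : ∑ u ∈ s, Finsupp.single ((insert v s).erase u)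
      ((-1 : F) ^ ((insert v s).filter (· < u)).card) ∈ M := by
    refine Submodule.sum_mem _ fun u hu => ?_
    have := M.smul_mem ((-1 : F) ^ ((insert v s).filter (· < u)).card) (h u hu)
    rwa [Finsupp.smul_single, smul_eq_mul, mul_one] at this
  have h1 := (M.add_mem_iff_left hs).mp hb
  -- Multiplying by the sign of `s` in the boundary once more makes the coefficient a square, hence
  -- `1`.
  have h2 := M.smul_mem ((-1 : F) ^ ((insert v s).filter (· < v)).card) h1
  rwa [Finsupp.smul_single, smul_eq_mul, ← pow_add, ← two_mul, pow_mul, neg_one_sq, one_pow] at h2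

/-- `Z / (B ∩ Z)` embeds in `V / B`, where its image lies in the span of the classes of the `g i`.
-/
theorem finrank_subquotient_le {F V : Type*} [Field F] [AddCommGroup V] [Module F V]
    {Z B : Submodule F V} {κ : Type*} (G : Finset κ) (g : κ → V)
    (h : Z ≤ Submodule.span F (g '' G) ⊔ B) : Module.finrank F (Subquotient Z B) ≤ G.card := by
  classical
  change Module.finrank F (Z ⧸ B.comap Z.subtype) ≤ G.card
  set f : (Z ⧸ B.comap Z.subtype) →ₗ[F] V ⧸ B := Submodule.mapQ _ B Z.subtype le_rfl with hfdef
  have hf : Function.Injective f := by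
    rw [← LinearMap.ker_eq_bot, hfdef, Submodule.ker_mapQ]
    exact Submodule.mkQ_map_self _
  have hG : ((G.image fun i => B.mkQ (g i) : Finset (V ⧸ B)) : Set (V ⧸ B)) = B.mkQ '' (g '' G) := by
    rw [Finset.coe_image, Set.image_image]
  have hrange : LinearMap.range f ≤
      Submodule.span F ((G.image fun i => B.mkQ (g i) : Finset (V ⧸ B)) : Set (V ⧸ B)) := by
    rw [hfdef, Submodule.range_mapQ, Submodule.range_subtype, hG, ← Submodule.map_span]
    refine (Submodule.map_mono h).trans ?_
    rw [Submodule.map_sup, Submodule.mkQ_map_self, sup_bot_eq]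
  calc Module.finrank F (Z ⧸ B.comap Z.subtype) = Module.finrank F (LinearMap.range f) :=
        (LinearMap.finrank_range_of_inj hf).symm
    _ ≤ _ := Submodule.finrank_mono hrange
    _ ≤ _ := finrank_span_finset_le_card _
    _ ≤ G.card := Finset.card_image_le

end SimplicialHomology

/-! ### Broken elements and the rank bound for one ordering -/

namespace ProjArrangement

variable {n : ℕ}

/-- The elements of `S` that are not before `x`. -/
def upperPart (pos : RP n → ℕ) (S : Finset (RP n)) (x : RP n) : Finset (RP n) :=
  S.filter fun y => pos x ≤ pos y

/-- `x ∈ S` is broken if a point of `H` before `x` lies in the span of the elements of `S` that are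
not before `x`. -/
def IsBroken (H : Finset (RP n)) (pos : RP n → ℕ) (S : Finset (RP n)) (x : RP n) : Prop :=
  x ∈ S ∧ ∃ z ∈ H, pos z < pos x ∧ z.submodule ≤ linSpan (upperPart pos S x : Set (RP n))

/-- `x` is the last broken element of `S`. -/
def IsLastBroken (H : Finset (RP n)) (pos : RP n → ℕ) (S : Finset (RP n)) (x : RP n) : Prop :=
  IsBroken H pos S x ∧ ∀ y ∈ S, pos x < pos y → ¬ IsBroken H pos S y

open Classical in
/-- The `n`-element subsets of `H` that form a basis with `w` and have a broken element. -/
noncomputable def brokenSets (H : Finset (RP n)) (w : RP n) (pos : RP n → ℕ) :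
    Finset (Finset (RP n)) :=
  (H.powersetCard n).filter fun S =>
    linSpan (insert w (S : Set (RP n))) = ⊤ ∧ ∃ x, IsLastBroken H pos S x

open Classical in
-- The filter in `numDependent` runs over sets, the images of the finsets in `H.powersetCard n`; the
-- coercion is injective, so the count over finsets is the same.
theorem numDependent_eq_card (H : Finset (RP n)) (w : RP n) :
    numDependent H w = ((H.powersetCard n).filter fun S : Finset (RP n) => w ∉ S ∧
      Module.finrank ℝ (linSpan (insert w (S : Set (RP n)))) < n + 1).card := by
  rw [numDependent, ← Finset.card_image_of_injective _ Finset.coe_injective]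
  congr 1
  ext R
  simp only [Finset.mem_filter, Finset.mem_image, Finset.bind_def, Finset.mem_sup,
    Finset.pure_def, Finset.mem_singleton]
  constructor
  · rintro ⟨⟨S, hS, rfl⟩, h⟩
    exact ⟨S, ⟨hS, h⟩, rfl⟩
  · rintro ⟨S, ⟨hS, h⟩, rfl⟩
    exact ⟨⟨S, hS, rfl⟩, h⟩

theorem exists_isLastBroken {H S : Finset (RP n)} {pos : RP n → ℕ}
    (h : ∃ x, IsBroken H pos S x) : ∃ x, IsLastBroken H pos S x := by
  classical
  obtain ⟨x, hx⟩ := h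
  obtain ⟨y, hy, hmax⟩ := (S.filter (IsBroken H pos S)).exists_max_image pos
    ⟨x, Finset.mem_filter.mpr ⟨hx.1, hx⟩⟩
  refine ⟨y, (Finset.mem_filter.mp hy).2, fun z hz hlt hb => ?_⟩
  exact absurd (hmax z (Finset.mem_filter.mpr ⟨hz, hb⟩)) (not_le.mpr hlt)

theorem IsLastBroken.unique {H S : Finset (RP n)} {pos : RP n → ℕ} (hinj : Set.InjOn pos H)
    (hS : S ⊆ H) {x y : RP n} (hx : IsLastBroken H pos S x) (hy : IsLastBroken H pos S y) :
    x = y := by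
  refine hinj (hS hx.1.1) (hS hy.1.1) (le_antisymm ?_ ?_)
  · exact not_lt.mp fun h => hy.2 x hx.1.1 h hx.1
  · exact not_lt.mp fun h => hx.2 y hy.1.1 h hy.1

theorem upperPart_eq_of_upperPart_eq {pos : RP n → ℕ} {S S' : Finset (RP n)} {x y : RP n}
    (h : upperPart pos S x = upperPart pos S' x) (hxy : pos x ≤ pos y) :
    upperPart pos S y = upperPart pos S' y := by
  ext z
  have hz := Finset.ext_iff.mp h z
  simp only [upperPart, Finset.mem_filter] at hz ⊢
  constructor <;> rintro ⟨h1, h2⟩ <;> have := hxy.trans h2 <;> tauto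

/-- Whether `y` is broken depends only on the elements from `y` on; hence changes of `S` before `x`
do not affect `x` being last broken. -/
theorem IsLastBroken.congr {H S S' : Finset (RP n)} {pos : RP n → ℕ} {x : RP n}
    (hx : IsLastBroken H pos S x) (h : upperPart pos S x = upperPart pos S' x) :
    IsLastBroken H pos S' x := by
  have hmem : ∀ y, pos x ≤ pos y → (y ∈ S ↔ y ∈ S') := fun y hy => by
    simpa [upperPart, hy] using Finset.ext_iff.mp h y
  refine ⟨⟨(hmem x le_rfl).mp hx.1.1, h ▸ hx.1.2⟩, fun y hy hxy hb => ?_⟩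
  refine hx.2 y ((hmem y hxy.le).mpr hy) hxy ⟨(hmem y hxy.le).mpr hy, ?_⟩
  rw [upperPart_eq_of_upperPart_eq h hxy.le]
  exact hb.2

theorem upperPart_erase {pos : RP n → ℕ} {S : Finset (RP n)} {m x : RP n} [DecidableEq (RP n)]
    (h : pos m < pos x) : upperPart pos (S.erase m) x = upperPart pos S x := by
  ext y
  simp only [upperPart, Finset.mem_filter, Finset.mem_erase]
  refine ⟨fun hy => ⟨hy.1.2, hy.2⟩, fun hy => ⟨⟨?_, hy.1⟩, hy.2⟩⟩
  rintro rfl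
  omega

/-- Remove the first element `x`. If `x` were in the span of the rest, then the first element of the
rest would be broken, with `x` as the earlier point. -/
theorem finrank_linSpan_eq_card_of_not_isBroken {H S : Finset (RP n)} {pos : RP n → ℕ}
    (hinj : Set.InjOn pos H) (hS : S ⊆ H) (h : ∀ x, ¬ IsBroken H pos S x) :
    Module.finrank ℝ (linSpan (S : Set (RP n))) = S.card := by
  classical
  induction hc : S.card generalizing S with
  | zero => simp [Finset.card_eq_zero.mp hc, linSpan_empty]
  | succ c ih =>
    obtain ⟨x, hx, hmin⟩ := S.exists_min_image pos (Finset.card_pos.mp (by omega))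
    have hlt : ∀ y ∈ S.erase x, pos x < pos y := fun y hy =>
      lt_of_le_of_ne (hmin y (Finset.mem_of_mem_erase hy)) fun he =>
        Finset.ne_of_mem_erase hy (hinj (hS hx) (hS (Finset.mem_of_mem_erase hy)) he).symm
    have h' : ∀ y, ¬ IsBroken H pos (S.erase x) y := by
      rintro y ⟨hy, z, hz, hzy, hzs⟩
      rw [upperPart_erase (hlt y hy)] at hzs
      exact h y ⟨Finset.mem_of_mem_erase hy, z, hz, hzy, hzs⟩
    have hr := ih ((Finset.erase_subset x S).trans hS) h' (by rw [Finset.card_erase_of_mem hx, hc]; rfl)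
    have hxs : ¬ x.submodule ≤ linSpan ((S.erase x : Finset (RP n)) : Set (RP n)) := by
      intro hle
      rcases (S.erase x).eq_empty_or_nonempty with he | hne
      · rw [he, Finset.coe_empty, linSpan_empty] at hle
        exact not_submodule_le_bot x hle
      · obtain ⟨y, hy, hymin⟩ := (S.erase x).exists_min_image pos hne
        refine h' y ⟨hy, x, hS hx, hlt y hy, ?_⟩
        rwa [upperPart, Finset.filter_true_of_mem hymin]
    rw [← Finset.insert_erase hx, Finset.coe_insert, finrank_linSpan_insert hxs, hr]

open SimplicialHomology in
/-- The rank of `Hₙ(K^H, K^H_{n-1})` is bounded through any ordering of `H`. -/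
theorem finrank_relHomology_le {F : Type*} [Field F] [LinearOrder (RP n)]
    {H : Finset (RP n)} {w : RP n} (hw : w ∈ H) {pos : RP n → ℕ} (hinj : Set.InjOn pos H) :
    Module.finrank F (RelHomology F (KComplex H) (skeletonLT (KComplex H) n) n) ≤
      numDependent H w + (brokenSets H w pos).card := by
  classical
  set K := KComplex H
  set B := relBoundaries F K (skeletonLT K n) n
  set D := (H.powersetCard n).filter fun S : Finset (RP n) => w ∉ S ∧
    Module.finrank ℝ (linSpan (insert w (S : Set (RP n)))) < n + 1
  -- By uniqueness of the last broken element, `m` can be chosen as a function of `S` alone; `w` is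
  -- a dummy value where there is none.
  have hm : ∀ S : Finset (RP n), ∃ m : RP n, ∀ x, S ⊆ H → IsLastBroken H pos S x →
      m ∈ H ∧ m.submodule ≤ linSpan (upperPart pos S x : Set (RP n)) ∧
      ∀ z ∈ H, z.submodule ≤ linSpan (upperPart pos S x : Set (RP n)) → pos m ≤ pos z := by
    intro S
    by_cases hex : S ⊆ H ∧ ∃ x, IsLastBroken H pos S x
    · obtain ⟨hS, x, hx⟩ := hex
      obtain ⟨hxS, z, hz, -, hzs⟩ := hx.1
      obtain ⟨m, hm, hmin⟩ := (H.filter fun p =>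
        p.submodule ≤ linSpan (upperPart pos S x : Set (RP n))).exists_min_image pos
        ⟨z, Finset.mem_filter.mpr ⟨hz, hzs⟩⟩
      refine ⟨m, fun y _ hy => ?_⟩
      obtain rfl := hy.unique hinj hS hx
      exact ⟨(Finset.mem_filter.mp hm).1, (Finset.mem_filter.mp hm).2,
        fun z hz hzs => hmin z (Finset.mem_filter.mpr ⟨hz, hzs⟩)⟩
    · exact ⟨w, fun x hS hx => absurd ⟨hS, x, hx⟩ hex⟩
  choose m hm using hm
  let g : Finset (RP n) ⊕ Finset (RP n) → (Finset (RP n) →₀ F) :=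
    Sum.elim (fun S => Finsupp.single (insert w S) 1) (fun S => Finsupp.single (insert (m S) S) 1)
  set M := Submodule.span F (g '' (D.disjSum (brokenSets H w pos) : Finset _)) ⊔ B
  have hBM : B ≤ M := le_sup_right
  have hgen : ∀ i ∈ D.disjSum (brokenSets H w pos), g i ∈ M := fun i hi =>
    Submodule.mem_sup_left (Submodule.subset_span ⟨i, hi, rfl⟩)
  -- simplices containing `w`
  have hwmem : ∀ Q : Finset (RP n), Q ⊆ H → Q.card = n + 1 → linSpan (Q : Set (RP n)) ≠ ⊤ →
      w ∈ Q → Finsupp.single Q (1 : F) ∈ M := by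
    intro Q hQ hc hspan hwQ
    have h1 := hgen (Sum.inl (Q.erase w)) (Finset.inl_mem_disjSum.mpr (by
      simp only [D, Finset.mem_filter, Finset.mem_powersetCard]
      refine ⟨⟨(Finset.erase_subset _ _).trans hQ, by rw [Finset.card_erase_of_mem hwQ, hc]; rfl⟩,
        Finset.notMem_erase _ _, ?_⟩
      rw [← Finset.coe_insert, Finset.insert_erase hwQ]
      refine lt_of_le_of_ne ((finrank_linSpan_le_card Q).trans_eq hc) ?_
      rwa [Ne, ← linSpan_eq_top_iff]))
    simpa only [g, Sum.elim_inl, Finset.insert_erase hwQ] using h1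
  have hsub : ∀ {Q : Finset (RP n)} {v : RP n}, Q ⊆ H → v ∈ H → ∀ u, (insert v Q).erase u ⊆ H :=
    fun hQ hv u => (Finset.erase_subset _ _).trans (Finset.insert_subset_iff.mpr ⟨hv, hQ⟩)
  have hcard : ∀ {Q : Finset (RP n)} {v : RP n}, Q.card = n + 1 → v ∉ Q → ∀ u ∈ Q,
      ((insert v Q).erase u).card = n + 1 := by
    intro Q v hc hv u hu
    rw [Finset.card_erase_of_mem (Finset.mem_insert_of_mem hu), Finset.card_insert_of_notMem hv, hc]
    rfl
  have hface : ∀ {Q : Finset (RP n)} {v : RP n}, Q ⊆ H → v ∈ H →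
      linSpan (insert v (Q : Set (RP n))) ≠ ⊤ → insert v Q ∈ K.faces := by
    intro Q v hQ hv hs
    exact ⟨Finset.insert_nonempty _ _, Finset.insert_subset_iff.mpr ⟨hv, hQ⟩, by
      rwa [Finset.coe_insert]⟩
  have hns : ∀ {Q : Finset (RP n)} {v : RP n}, linSpan (insert v (Q : Set (RP n))) ≠ ⊤ →
      ∀ u, linSpan (((insert v Q).erase u : Finset (RP n)) : Set (RP n)) ≠ ⊤ := by
    intro Q v hs u htop
    refine hs (top_le_iff.mp (htop ▸ linSpan_mono ?_))
    rw [← Finset.coe_insert]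
    exact Finset.coe_subset.mpr (Finset.erase_subset _ _)
  have hwspan : ∀ Q : Finset (RP n), Q ⊆ H → Q.card = n + 1 →
      linSpan (insert w (Q : Set (RP n))) ≠ ⊤ → Finsupp.single Q (1 : F) ∈ M := by
    intro Q hQ hc hs
    by_cases hwQ : w ∈ Q
    · exact hwmem Q hQ hc (by rwa [Set.insert_eq_of_mem (Finset.mem_coe.mpr hwQ)] at hs) hwQ
    -- Cone from `w`: all other faces of `insert w Q` contain `w`.
    refine single_mem_of_erase_mem hBM hwQ (hface hQ hw hs) hc fun u hu => ?_
    refine hwmem _ (hsub hQ hw u) (hcard hc hwQ u hu) (hns hs u) ?_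
    exact Finset.mem_erase.mpr ⟨fun h => hwQ (h ▸ hu), Finset.mem_insert_self _ _⟩
  have hlt : ∀ {Q : Finset (RP n)} {x : RP n}, Q ⊆ H → IsLastBroken H pos Q x →
      pos (m Q) < pos x := by
    intro Q x hQ hx
    obtain ⟨_, z, hz, hzx, hzs⟩ := hx.1
    exact ((hm Q x hQ hx).2.2 z hz hzs).trans_lt hzx
  have hmeq : ∀ {Q Q' : Finset (RP n)} {x : RP n}, Q ⊆ H → Q' ⊆ H → IsLastBroken H pos Q x →
      upperPart pos Q x = upperPart pos Q' x → m Q' = m Q := by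
    intro Q Q' x hQ hQ' hx hup
    obtain ⟨h1, h2, h3⟩ := hm Q x hQ hx
    obtain ⟨h1', h2', h3'⟩ := hm Q' x hQ' (hx.congr hup)
    rw [← hup] at h2' h3'
    exact hinj h1' h1 (le_antisymm (h3' _ h1 h2) (h3 _ h1' h2'))
  -- simplices containing the first point of the broken span
  have hmmem : ∀ (Q : Finset (RP n)) (x : RP n), Q ⊆ H → Q.card = n + 1 →
      IsLastBroken H pos Q x → m Q ∈ Q → Finsupp.single Q (1 : F) ∈ M := by
    intro Q x hQ hc hx hmem
    by_cases hs : linSpan (insert w (Q : Set (RP n))) = ⊤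
    swap
    · exact hwspan Q hQ hc hs
    -- Since `m Q` lies before `x`, erasing it keeps `x` last broken with the same span. So the
    -- generator attached to `Q.erase (m Q)` is `Q` itself.
    have hup : upperPart pos Q x = upperPart pos (Q.erase (m Q)) x :=
      (upperPart_erase (hlt hQ hx)).symm
    have hSH : Q.erase (m Q) ⊆ H := (Finset.erase_subset _ _).trans hQ
    have hmS : (m Q).submodule ≤ linSpan (Q.erase (m Q) : Finset (RP n)) := by
      refine (hm Q x hQ hx).2.1.trans (linSpan_mono ?_)
      rw [hup]
      exact Finset.coe_subset.mpr (Finset.filter_subset _ _)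
    have hQS : linSpan (Q : Set (RP n)) = linSpan (Q.erase (m Q) : Finset (RP n)) := by
      rw [← linSpan_insert_of_le hmS, ← Finset.coe_insert, Finset.insert_erase hmem]
    have h1 := hgen (Sum.inr (Q.erase (m Q))) (Finset.inr_mem_disjSum.mpr (by
      simp only [brokenSets, Finset.mem_filter, Finset.mem_powersetCard]
      refine ⟨⟨hSH, by rw [Finset.card_erase_of_mem hmem, hc]; rfl⟩, ?_, x, hx.congr hup⟩
      rw [linSpan_insert, ← hQS, ← linSpan_insert, hs]))
    simpa only [g, Sum.elim_inr, hmeq hQ hSH hx hup, Finset.insert_erase hmem] using h1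
  -- Induction on the sum of the positions of the vertices.
  have key : ∀ (N : ℕ) (Q : Finset (RP n)), ∑ y ∈ Q, pos y = N → Q ⊆ H → Q.card = n + 1 →
      linSpan (Q : Set (RP n)) ≠ ⊤ → Finsupp.single Q (1 : F) ∈ M := by
    intro N
    induction N using Nat.strong_induction_on with
    | _ N ih =>
    intro Q hN hQ hc hspan
    have hbroken : ∃ x, IsBroken H pos Q x := by
      by_contra hno
      push Not at hno
      refine hspan (linSpan_eq_top_iff.mpr ?_)
      rw [finrank_linSpan_eq_card_of_not_isBroken hinj hQ hno, hc]
    obtain ⟨x, hx⟩ := exists_isLastBroken hbroken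
    by_cases hmem : m Q ∈ Q
    · exact hmmem Q x hQ hc hx hmem
    obtain ⟨hmH, hms, -⟩ := hm Q x hQ hx
    have hmx := hlt hQ hx
    have hs : linSpan (insert (m Q) (Q : Set (RP n))) ≠ ⊤ := by
      rwa [linSpan_insert_of_le (hms.trans
        (linSpan_mono (Finset.coe_subset.mpr (Finset.filter_subset _ _))))]
    refine single_mem_of_erase_mem hBM hmem (hface hQ hmH hs) hc fun u hu => ?_
    have hum : u ≠ m Q := fun h => hmem (h ▸ hu)
    -- Dropping `u` before `x` keeps the part from `x` on, so `m` is unchanged and now a vertex.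
    -- Dropping `u` from `x` on replaces it by the earlier point `m Q`, and the sum decreases.
    rcases lt_or_ge (pos u) (pos x) with hux | hxu
    · have hup : upperPart pos Q x = upperPart pos ((insert (m Q) Q).erase u) x := by
        rw [upperPart_erase hux]
        simp [upperPart, Finset.filter_insert, hmx]
      refine hmmem _ x (hsub hQ hmH u) (hcard hc hmem u hu) (hx.congr hup) ?_
      rw [hmeq hQ (hsub hQ hmH u) hx hup]
      exact Finset.mem_erase.mpr ⟨hum.symm, Finset.mem_insert_self _ _⟩
    · refine ih _ ?_ _ rfl (hsub hQ hmH u) (hcard hc hmem u hu) (hns hs u)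
      have h1 := Finset.add_sum_erase (insert (m Q) Q) pos (Finset.mem_insert_of_mem hu)
      rw [Finset.sum_insert hmem, hN] at h1
      omega
  refine (finrank_subquotient_le (D.disjSum (brokenSets H w pos)) g ?_).trans_eq ?_
  -- All `n`-chains, not only the cycles, are generated.
  · refine (relCycles_le_chains _ _ _).trans ?_
    rw [chains, Finsupp.supported_eq_span_single, Submodule.span_le]
    rintro _ ⟨Q, ⟨hQ, hc⟩, rfl⟩
    exact key _ Q rfl hQ.2.1 hc hQ.2.2
  · rw [Finset.card_disjSum]
    rw [numDependent_eq_card]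
    congr!

end ProjArrangement

/-! ### Counting orderings by swap symmetry -/

namespace OrderingCount

variable {α : Type*} [DecidableEq α] {T : ℕ}

/-- Double counting of pairs `(π, y)` for a family of bijections invariant under the swaps of
elements of `Y`. -/
theorem card_filter_mul_card {P : Finset (α ≃ Fin T)} {Y : Finset α}
    {R : (α ≃ Fin T) → α → Prop} [∀ π, DecidablePred (R π)]
    [∀ a, DecidablePred fun π => R π a] {c : ℕ}
    (hP : ∀ a ∈ Y, ∀ b ∈ Y, ∀ π ∈ P, (Equiv.swap a b).trans π ∈ P)
    (hR : ∀ a ∈ Y, ∀ b ∈ Y, ∀ π ∈ P, R π b → R ((Equiv.swap a b).trans π) a)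
    (hc : ∀ π ∈ P, (Y.filter (R π)).card = c) {u : α} (hu : u ∈ Y) :
    (P.filter fun π => R π u).card * Y.card = P.card * c := by
  have hle : ∀ a ∈ Y, ∀ b ∈ Y, (P.filter fun π => R π b).card ≤ (P.filter fun π => R π a).card := by
    intro a ha b hb
    refine Finset.card_le_card_of_injOn (fun π => (Equiv.swap a b).trans π) ?_ ?_
    · intro π hπ
      obtain ⟨h1, h2⟩ := Finset.mem_filter.mp hπ
      exact Finset.mem_filter.mpr ⟨hP a ha b hb π h1, hR a ha b hb π h1 h2⟩
    · intro π _ π' _ h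
      ext x
      simpa using congrArg (fun e : α ≃ Fin T => (e (Equiv.swap a b x) : ℕ)) h
  calc (P.filter fun π => R π u).card * Y.card
      = ∑ y ∈ Y, (P.filter fun π => R π y).card := by
        rw [Finset.sum_congr rfl fun y hy => le_antisymm (hle u hu y hy) (hle y hy u hu),
          Finset.sum_const, smul_eq_mul, mul_comm]
    _ = ∑ π ∈ P, (Y.filter (R π)).card := by
        simp only [Finset.card_filter]
        exact Finset.sum_comm
    _ = P.card * c := by
        rw [Finset.sum_congr rfl hc, Finset.sum_const, smul_eq_mul]

/-- Each ordering has exactly one first element of `Y`, and by symmetry every element of `Y` is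
first equally often. -/
theorem card_filter_isFirst_mul {P : Finset (α ≃ Fin T)} {Y : Finset α}
    (hP : ∀ a ∈ Y, ∀ b ∈ Y, ∀ π ∈ P, (Equiv.swap a b).trans π ∈ P) {u : α} (hu : u ∈ Y) :
    (P.filter fun π => ∀ z ∈ Y, π u ≤ π z).card * Y.card = P.card := by
  rw [card_filter_mul_card (R := fun π a => ∀ z ∈ Y, π a ≤ π z) (c := 1) hP ?_ ?_ hu, mul_one]
  · intro a ha b hb π _ h z hz
    simp only [Equiv.trans_apply, Equiv.swap_apply_left]
    refine h _ ?_
    rw [Equiv.swap_apply_def]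
    split_ifs <;> assumption
  · intro π _
    obtain ⟨x, hx, hmin⟩ := Y.exists_min_image π ⟨u, hu⟩
    rw [Finset.card_eq_one]
    refine ⟨x, Finset.ext fun y => ?_⟩
    rw [Finset.mem_filter, Finset.mem_singleton]
    refine ⟨fun h => π.injective (le_antisymm (h.2 x hx) (hmin y h.1)), ?_⟩
    rintro rfl
    exact ⟨hx, hmin⟩

/-- In a family of bijections invariant under the permutations of the largest member of a flag of
sets, the proportion of those for which `u l` comes first in `Y l` for all `l` is `∏ 1 / |Y l|`. -/
theorem card_filter_flag_mul_prod {P : Finset (α ≃ Fin T)} (Y : ℕ → Finset α) (u : ℕ → α) (r : ℕ)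
    (hmono : Monotone Y) (hu : ∀ l ∈ Finset.Icc 1 r, u l ∈ Y l)
    (hu' : ∀ l ∈ Finset.Icc 1 r, u l ∉ Y (l - 1))
    (hP : ∀ a ∈ Y r, ∀ b ∈ Y r, ∀ π ∈ P, (Equiv.swap a b).trans π ∈ P) :
    (P.filter fun π => ∀ l ∈ Finset.Icc 1 r, ∀ z ∈ Y l, π (u l) ≤ π z).card *
      ∏ l ∈ Finset.Icc 1 r, (Y l).card = P.card := by
  induction r generalizing P with
  | zero => simp
  | succ r ih =>
    have hr : r + 1 ∈ Finset.Icc 1 (r + 1) := by simp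
    have hsub : Finset.Icc 1 r ⊆ Finset.Icc 1 (r + 1) := Finset.Icc_subset_Icc le_rfl (by omega)
    have hfirst := card_filter_isFirst_mul hP (hu _ hr)
    set P' := P.filter fun π => ∀ z ∈ Y (r + 1), π (u (r + 1)) ≤ π z with hP'
    rw [← hfirst, ← ih (P := P') (fun l hl => hu l (hsub hl)) (fun l hl => hu' l (hsub hl)) ?_,
      hP', Finset.filter_filter, Finset.prod_Icc_succ_top (by omega), mul_assoc]
    · congr 2
      refine Finset.filter_congr fun π _ => ?_
      constructor
      · exact fun h => ⟨h _ hr, fun l hl => h l (hsub hl)⟩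
      · rintro ⟨h1, h2⟩ l hl
        rcases eq_or_ne l (r + 1) with rfl | hne
        · exact h1
        · exact h2 l (by simp only [Finset.mem_Icc] at hl ⊢; omega)
    -- The subfamily `P'` stays invariant: a swap inside `Y r` fixes `u (r + 1)`, which lies outside
    -- `Y r`, and preserves `Y (r + 1)`.
    · intro a ha b hb π hπ
      obtain ⟨h1, h2⟩ := Finset.mem_filter.mp hπ
      have ha' := hmono r.le_succ ha
      have hb' := hmono r.le_succ hb
      refine Finset.mem_filter.mpr ⟨hP a ha' b hb' π h1, fun z hz => ?_⟩
      have hne : u (r + 1) ∉ Y r := hu' _ hr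
      rw [Equiv.trans_apply, Equiv.trans_apply, Equiv.swap_apply_of_ne_of_ne
        (fun h : u (r + 1) = a => hne (h ▸ ha)) (fun h : u (r + 1) = b => hne (h ▸ hb))]
      refine h2 _ ?_
      rw [Equiv.swap_apply_def]
      split_ifs <;> assumption

variable [Fintype α]

theorem card_filter_apply_eq (hT : Fintype.card α = T) (w : α) (p : Fin T) :
    (Finset.univ.filter fun π : α ≃ Fin T => π w = p).card = (T - 1).factorial := by
  have h := card_filter_mul_card (P := (Finset.univ : Finset (α ≃ Fin T))) (Y := Finset.univ)
    (R := fun π a => π a = p) (c := 1) (by simp) (by simp) ?_ (Finset.mem_univ w)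
  · have hpos : 0 < T := p.pos
    rw [Finset.card_univ, Finset.card_univ, hT, Fintype.card_equiv (Fintype.equivFinOfCardEq hT), hT,
      mul_one, ← Nat.mul_factorial_pred hpos.ne', mul_comm] at h
    exact Nat.eq_of_mul_eq_mul_left hpos h
  · intro π _
    rw [Finset.card_eq_one]
    refine ⟨π.symm p, Finset.ext fun y => ?_⟩
    simp [Equiv.eq_symm_apply]

theorem card_filter_apply_eq_apply_eq (hT : Fintype.card α = T) {w u : α} (hwu : w ≠ u)
    {p q : Fin T} (hpq : p ≠ q) :
    (Finset.univ.filter fun π : α ≃ Fin T => π w = p ∧ π u = q).card = (T - 2).factorial := by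
  have h := card_filter_mul_card (P := Finset.univ.filter fun π : α ≃ Fin T => π w = p)
    (Y := Finset.univ.erase w) (R := fun π a => π a = q) (c := 1) ?_ (by simp) ?_
    (Finset.mem_erase.mpr ⟨hwu.symm, Finset.mem_univ u⟩)
  · have hpos : 2 ≤ T := by
      have h1 := p.2
      have h2 := q.2
      have h3 : (p : ℕ) ≠ q := fun h => hpq (Fin.ext h)
      omega
    rw [Finset.filter_filter, card_filter_apply_eq hT, Finset.card_erase_of_mem (Finset.mem_univ w),
      Finset.card_univ, hT, mul_one, ← Nat.mul_factorial_pred (by omega : T - 1 ≠ 0), mul_comm] at h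
    exact Nat.eq_of_mul_eq_mul_left (by omega) h
  · intro a ha b hb π hπ
    simp only [Finset.mem_filter, Finset.mem_univ, true_and, Finset.mem_erase, and_true] at ha hb hπ ⊢
    rw [Equiv.trans_apply, Equiv.swap_apply_of_ne_of_ne ha.symm hb.symm, hπ]
  · intro π hπ
    rw [Finset.card_eq_one]
    refine ⟨π.symm q, Finset.ext fun y => ?_⟩
    have hπ' : π w = p := by simpa using hπ
    simp only [Finset.mem_filter, Finset.mem_univ, Finset.mem_erase, and_true, Finset.mem_singleton,
      Equiv.eq_symm_apply]
    refine ⟨fun h => h.2, fun h => ⟨?_, h⟩⟩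
    rintro rfl
    exact hpq (hπ'.symm.trans h)

/-- The number of orderings with `w` in position `p`, `u` in position `q > p`, and all of `A` after
`u`. -/
theorem card_filter_after (hT : Fintype.card α = T) {w u : α} (hwu : w ≠ u)
    {p q : Fin T} (hpq : p < q) (A : Finset α) (hwA : w ∉ A) (huA : u ∉ A) :
    (Finset.univ.filter fun π : α ≃ Fin T => (π w = p ∧ π u = q) ∧ ∀ z ∈ A, q < π z).card =
      (T - 1 - q).descFactorial A.card * (T - 2 - A.card).factorial := by
  induction A using Finset.induction_on with
  | empty => simp [card_filter_apply_eq_apply_eq hT hwu hpq.ne]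
  | insert a A ha ih =>
    simp only [Finset.mem_insert, not_or] at hwA huA
    have ih := ih hwA.2 huA.2
    have hY : (Finset.univ \ insert w (insert u A)).card = T - 2 - A.card := by
      rw [Finset.card_sdiff_of_subset (Finset.subset_univ _), Finset.card_univ, hT,
        Finset.card_insert_of_notMem (by simp [hwu, hwA.2]), Finset.card_insert_of_notMem huA.2]
      omega
    have hmem : ∀ y, y ∈ Finset.univ \ insert w (insert u A) ↔ y ≠ w ∧ y ≠ u ∧ y ∉ A := by
      simp
    have haY := (hmem a).mpr ⟨fun h => hwA.1 h.symm, fun h => huA.1 h.symm, ha⟩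
    -- The elements outside `A`, `w` and `u` are interchangeable. Of the `T - 1 - q` positions after
    -- `q`, those not occupied by `A` are filled by such elements.
    have h := card_filter_mul_card (P := Finset.univ.filter fun π : α ≃ Fin T =>
        (π w = p ∧ π u = q) ∧ ∀ z ∈ A, q < π z) (Y := Finset.univ \ insert w (insert u A))
      (R := fun π y => q < π y) (c := T - 1 - q - A.card) ?_ (by simp) ?_ haY
    · have hpos : 0 < T - 2 - A.card := hY ▸ Finset.card_pos.mpr ⟨a, haY⟩
      rw [Finset.filter_filter, ih, hY, ← Nat.mul_factorial_pred hpos.ne'] at h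
      rw [Finset.card_insert_of_notMem ha, Nat.descFactorial_succ, Nat.sub_add_eq]
      have hcongr : (Finset.univ.filter fun π : α ≃ Fin T =>
          (π w = p ∧ π u = q) ∧ ∀ z ∈ insert a A, q < π z) = Finset.univ.filter fun π : α ≃ Fin T =>
          ((π w = p ∧ π u = q) ∧ ∀ z ∈ A, q < π z) ∧ q < π a := by
        refine Finset.filter_congr fun π _ => ?_
        rw [Finset.forall_mem_insert]
        tauto
      rw [hcongr]
      refine Nat.eq_of_mul_eq_mul_right hpos (h.trans ?_)
      ring
    · intro x hx y hy π hπ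
      rw [hmem] at hx hy
      simp only [Finset.mem_filter, Finset.mem_univ, true_and] at hπ ⊢
      simp only [Equiv.trans_apply]
      rw [Equiv.swap_apply_of_ne_of_ne hx.1.symm hy.1.symm,
        Equiv.swap_apply_of_ne_of_ne hx.2.1.symm hy.2.1.symm]
      refine ⟨hπ.1, fun z hz => ?_⟩
      rw [Equiv.swap_apply_of_ne_of_ne (fun h : z = x => hx.2.2 (h ▸ hz))
        (fun h : z = y => hy.2.2 (h ▸ hz))]
      exact hπ.2 z hz
    · intro π hπ
      simp only [Finset.mem_filter, Finset.mem_univ, true_and] at hπ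
      obtain ⟨⟨h1, h2⟩, h3⟩ := hπ
      have hset : (Finset.univ \ insert w (insert u A)).filter (fun y => q < π y) =
          ((Finset.Ioi q).map π.symm.toEmbedding) \ A := by
        ext y
        simp only [Finset.mem_filter, hmem, Finset.mem_sdiff, Finset.mem_map_equiv, Equiv.symm_symm,
          Finset.mem_Ioi]
        refine ⟨fun h => ⟨h.2, h.1.2.2⟩, fun h => ⟨⟨?_, ?_, h.2⟩, h.1⟩⟩
        · rintro rfl
          exact absurd (h1 ▸ h.1) (not_lt.mpr hpq.le)
        · rintro rfl
          exact absurd (h2 ▸ h.1) (lt_irrefl _)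
      rw [hset, Finset.card_sdiff_of_subset, Finset.card_map, Fin.card_Ioi]
      intro z hz
      simpa [Finset.mem_map_equiv] using h3 z hz

end OrderingCount

/-! ### Broken sets as broken flags -/

namespace ProjArrangement

variable {n : ℕ}

/-- The entry `u_l` of the tuple `U = (u_s, …, u_1)`; it is `w` if `l = 0`. -/
def entryFromEnd (w : RP n) {s : ℕ} (U : Fin s → RP n) (l : ℕ) : RP n :=
  if h : s - l < s then U ⟨s - l, h⟩ else w

theorem entryFromEnd_eq (w : RP n) {s : ℕ} (U : Fin s → RP n) (j : Fin s) :
    entryFromEnd w U (s - j) = U j := by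
  have h : s - (s - (j : ℕ)) = j := by omega
  simp [entryFromEnd, h]

open Classical in
/-- The points of `H` in the span of the last `l` entries of `U`. -/
noncomputable def flagSet (H : Finset (RP n)) {s : ℕ} (U : Fin s → RP n) (l : ℕ) :
    Finset (RP n) :=
  H.filter fun p => p.submodule ≤ linSpan (U '' {j | s ≤ (j : ℕ) + l})

theorem card_flagSet (H : Finset (RP n)) {s : ℕ} (U : Fin s → RP n) (l : ℕ) :
    (flagSet H U l).card = flagCount H U l := rfl

theorem mem_flagSet {H : Finset (RP n)} {s : ℕ} {U : Fin s → RP n} {l : ℕ} {p : RP n} :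
    p ∈ flagSet H U l ↔ p ∈ H ∧ p.submodule ≤ linSpan (U '' {j | s ≤ (j : ℕ) + l}) := by
  simp [flagSet]

theorem flagSet_mono (H : Finset (RP n)) {s : ℕ} (U : Fin s → RP n) : Monotone (flagSet H U) := by
  intro l l' hl p hp
  rw [mem_flagSet] at hp ⊢
  refine ⟨hp.1, hp.2.trans (linSpan_mono (Set.image_mono fun j hj => ?_))⟩
  simp only [Set.mem_ofPred_eq] at hj ⊢
  omega

/-- The flag of `U = (u_s, …, u_1)` is broken at its last step: `u_l` comes first in the span of
`u_l, …, u_1` for `l < s`, and `u_s` comes before the span of `u_{s-1}, …, u_1` but is not the first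
in the span of `U`. -/
def IsBrokenFlag (H : Finset (RP n)) (w : RP n) (pos : RP n → ℕ) {s : ℕ} (U : Fin s → RP n) :
    Prop :=
  ((∀ z ∈ flagSet H U (s - 1), pos (entryFromEnd w U s) < pos z) ∧
    ∃ z ∈ flagSet H U s, pos z < pos (entryFromEnd w U s)) ∧
  ∀ l ∈ Finset.Icc 1 (s - 1), ∀ z ∈ flagSet H U l, pos (entryFromEnd w U l) ≤ pos z

theorem mem_indepTuplesAvoiding {H : Finset (RP n)} {w : RP n} {s : ℕ} {U : Fin s → RP n} :
    U ∈ indepTuplesAvoiding H w s ↔ (∀ j, U j ∈ H) ∧ Function.Injective U ∧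
      Module.finrank ℝ (linSpan (Set.range U)) = s ∧ ¬ w.submodule ≤ linSpan (Set.range U) := by
  simp [indepTuplesAvoiding]

open Classical in
theorem card_filter_pos_lt_le {H : Finset (RP n)} {pos : RP n → ℕ} (hinj : Set.InjOn pos H) (p : ℕ) :
    (H.filter fun y => 0 < pos y ∧ pos y < p).card ≤ p - 1 := by
  rw [show p - 1 = (Finset.Ioo 0 p).card by rw [Nat.card_Ioo, Nat.sub_zero]]
  refine Finset.card_le_card_of_injOn pos ?_ (hinj.mono ?_)
  · intro y hy
    simpa using (Finset.mem_filter.mp hy).2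
  · exact Finset.coe_subset.mpr (Finset.filter_subset _ _)

theorem exists_increasing_enumeration {pos : RP n → ℕ} {G : Finset (RP n)}
    (hinj : Set.InjOn pos G) {s : ℕ} (hs : G.card = s) :
    ∃ U : Fin s → RP n, Set.range U = G ∧ StrictMono (pos ∘ U) := by
  classical
  have hc : (G.image pos).card = s := by rw [Finset.card_image_of_injOn hinj, hs]
  have hex : ∀ j, ∃ y ∈ G, pos y = (G.image pos).orderEmbOfFin hc j := fun j =>
    Finset.mem_image.mp (Finset.orderEmbOfFin_mem _ hc j)
  choose U hUG hUpos using hex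
  refine ⟨U, Set.Subset.antisymm (Set.range_subset_iff.mpr hUG) fun y hy => ?_, fun i j hij => ?_⟩
  · have h1 : pos y ∈ Set.range ((G.image pos).orderEmbOfFin hc) := by
      rw [Finset.range_orderEmbOfFin]
      exact Finset.mem_coe.mpr (Finset.mem_image_of_mem pos hy)
    obtain ⟨j, hj⟩ := h1
    exact ⟨j, hinj (hUG j) hy ((hUpos j).trans hj)⟩
  · simp only [Function.comp_apply, hUpos]
    exact (OrderEmbedding.lt_iff_lt _).mpr hij

/-- This identifies the flag of `U` with the upper parts of `S`: in an increasing tuple the last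
entries are the elements from a given one on. -/
theorem image_eq_upperPart {pos : RP n → ℕ} {S : Finset (RP n)} {x : RP n} {s : ℕ}
    {U : Fin s → RP n} (hU : Set.range U = upperPart pos S x) (hmono : StrictMono (pos ∘ U))
    (j : Fin s) : U '' {i | s ≤ (i : ℕ) + (s - j)} = upperPart pos S (U j) := by
  have hmem : ∀ y, y ∈ Set.range U ↔ y ∈ S ∧ pos x ≤ pos y := fun y => by
    rw [hU]; simp [upperPart]
  ext y
  simp only [Set.mem_image, Set.mem_ofPred_eq, upperPart, Finset.coe_filter]
  constructor
  · rintro ⟨i, hi, rfl⟩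
    exact ⟨((hmem _).mp ⟨i, rfl⟩).1, hmono.monotone (Fin.le_def.mpr (by omega))⟩
  · rintro ⟨hy, hjy⟩
    obtain ⟨i, rfl⟩ := (hmem y).mpr ⟨hy, ((hmem _).mp ⟨j, rfl⟩).2.trans hjy⟩
    have : j ≤ i := hmono.le_iff_le.mp hjy
    exact ⟨i, by have := Fin.le_def.mp this; omega, rfl⟩

/-- Every broken set splits into the elements before its last broken element and a broken flag. -/
theorem exists_isBrokenFlag {H : Finset (RP n)} {w : RP n} (hw : w ∈ H) {pos : RP n → ℕ}
    (hinj : Set.InjOn pos H) (hw0 : pos w = 0) {S : Finset (RP n)} (hS : S ∈ brokenSets H w pos) :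
    ∃ k ∈ Finset.range (n - 1), ∃ U ∈ indepTuplesAvoiding H w (n - k), IsBrokenFlag H w pos U ∧
      k + 3 ≤ pos (entryFromEnd w U (n - k)) + 1 ∧
      ∃ B : Finset (RP n), B.card = k ∧
        (∀ y ∈ B, y ∈ H ∧ 0 < pos y ∧ pos y < pos (entryFromEnd w U (n - k))) ∧
        (S : Set (RP n)) = (B : Set (RP n)) ∪ Set.range U := by
  classical
  simp only [brokenSets, Finset.mem_filter, Finset.mem_powersetCard] at hS
  obtain ⟨⟨hSH, hSc⟩, htop, x, hx⟩ := hS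
  rw [linSpan_eq_top_iff, ← Finset.coe_insert] at htop
  have hwS : w ∉ S := by
    intro h
    rw [Finset.insert_eq_of_mem h] at htop
    have := finrank_linSpan_le_card S
    omega
  have hind : Module.finrank ℝ (linSpan ((insert w S : Finset (RP n)) : Set (RP n))) =
      (insert w S).card := by
    rw [htop, Finset.card_insert_of_notMem hwS, hSc]
  set G := upperPart pos S x with hG
  have hGS : G ⊆ S := Finset.filter_subset _ _
  have hmemG : ∀ y, y ∈ G ↔ y ∈ S ∧ pos x ≤ pos y := fun y => by simp [hG, upperPart]
  have hxG : x ∈ G := (hmemG x).mpr ⟨hx.1.1, le_rfl⟩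
  obtain ⟨-, z, hzH, hzx, hzs⟩ := hx.1
  have hwG : ¬ w.submodule ≤ linSpan (G : Set (RP n)) :=
    not_submodule_le_linSpan_of_notMem hind (hGS.trans (Finset.subset_insert _ _))
      (Finset.mem_insert_self _ _) fun h => hwS (hGS h)
  -- The span of a single point contains no other point; this is why `k` stops at `n - 2`.
  have hGc : 2 ≤ G.card := by
    by_contra hlt
    have h1 : G = {x} := by
      refine (Finset.eq_of_subset_of_card_le (Finset.singleton_subset_iff.mpr hxG) ?_).symm
      rw [Finset.card_singleton]
      omega
    rw [← hG, h1, Finset.coe_singleton] at hzs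
    have h2 : z = x := eq_of_submodule_le (hzs.trans (linSpan_le_iff.mpr (by simp)))
    rw [h2] at hzx
    exact lt_irrefl _ hzx
  have hGn : G.card ≤ n := (Finset.card_le_card hGS).trans_eq hSc
  obtain ⟨k, hk⟩ : ∃ k, k = n - G.card := ⟨_, rfl⟩
  have hGk : G.card = n - k := by omega
  obtain ⟨U, hU, hmono⟩ := exists_increasing_enumeration
    (hinj.mono (Finset.coe_subset.mpr (hGS.trans hSH))) hGk
  have hUG : ∀ j, U j ∈ G := fun j => Finset.mem_coe.mp (hU ▸ Set.mem_range_self j)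
  have hpos : 0 < n - k := by omega
  have hU0 : U ⟨0, hpos⟩ = x := by
    refine hinj (hSH (hGS (hUG _))) (hSH hx.1.1) (le_antisymm ?_ ((hmemG _).mp (hUG _)).2)
    obtain ⟨i, hi⟩ : x ∈ Set.range U := hU ▸ Finset.mem_coe.mpr hxG
    rw [← hi]
    exact hmono.monotone (Fin.le_def.mpr (Nat.zero_le _))
  have hentry : entryFromEnd w U (n - k) = x := by
    rw [← hU0]
    exact entryFromEnd_eq w U ⟨0, hpos⟩
  have hflag : ∀ j : Fin (n - k), ∀ z, z ∈ flagSet H U (n - k - j) ↔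
      z ∈ H ∧ z.submodule ≤ linSpan (upperPart pos S (U j) : Set (RP n)) := fun j z => by
    rw [mem_flagSet, image_eq_upperPart hU hmono]
  have hfirst : ∀ l ∈ Finset.Icc 1 (n - k - 1), ∀ z ∈ flagSet H U l,
      pos x < pos (entryFromEnd w U l) ∧ pos (entryFromEnd w U l) ≤ pos z := by
    intro l hl z hz
    rw [Finset.mem_Icc] at hl
    obtain ⟨j, hj⟩ : ∃ j : Fin (n - k), n - k - j = l :=
      ⟨⟨n - k - l, by omega⟩, by simp only; omega⟩
    subst hj
    rw [entryFromEnd_eq]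
    have hxj : pos x < pos (U j) := by
      rw [← hU0]
      exact hmono (Fin.lt_def.mpr (by simp only; omega))
    refine ⟨hxj, not_lt.mp fun hlt => hx.2 (U j) (hGS (hUG j)) hxj ⟨hGS (hUG j), z, ?_⟩⟩
    rw [hflag] at hz
    exact ⟨hz.1, hlt, hz.2⟩
  have hB : ∀ y ∈ S \ G, y ∈ H ∧ 0 < pos y ∧ pos y < pos x := by
    intro y hy
    obtain ⟨hyS, hyG⟩ := Finset.mem_sdiff.mp hy
    refine ⟨hSH hyS, Nat.pos_of_ne_zero fun h => hwS ?_, not_le.mp fun h => hyG ((hmemG y).mpr ⟨hyS, h⟩)⟩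
    rwa [hinj hw (hSH hyS) (hw0.trans h.symm)]
  have hBc : (S \ G).card = k := by
    rw [Finset.card_sdiff_of_subset hGS, hSc, hk]
  have hzS : z ∉ S := by
    intro hz
    refine not_submodule_le_linSpan_of_notMem hind (hGS.trans (Finset.subset_insert _ _))
      (Finset.mem_insert_of_mem hz) (fun h => ?_) hzs
    exact absurd ((hmemG z).mp h).2 (not_le.mpr hzx)
  refine ⟨k, by rw [Finset.mem_range]; omega, U, mem_indepTuplesAvoiding.mpr
    ⟨fun j => hSH (hGS (hUG j)), hmono.injective.of_comp, ?_, by rwa [hU]⟩, ⟨⟨?_, ?_⟩, ?_⟩, ?_,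
    S \ G, hBc, by rwa [hentry], ?_⟩
  · rw [hU, finrank_linSpan_eq_card_of_subset (hGS.trans (Finset.subset_insert _ _)) hind, hGk]
  · intro z hz
    rw [hentry]
    have := hfirst (n - k - 1) (by rw [Finset.mem_Icc]; omega) z hz
    exact this.1.trans_le this.2
  · refine ⟨z, ?_, by rwa [hentry]⟩
    have := (hflag ⟨0, hpos⟩ z).mpr ⟨hzH, by rwa [hU0]⟩
    simpa using this
  · exact fun l hl z hz => (hfirst l hl z hz).2
  -- The `k` elements of `S \ G` and the point `z ∉ S` lie strictly between `w` and `x`, so `k + 1 ≤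
  -- pos x - 1`. This is the lower limit `d ≥ k + 3`, with `d = pos x + 1`.
  · have h1 := card_filter_pos_lt_le hinj (pos x)
    have h2 : insert z (S \ G) ⊆ H.filter fun y => 0 < pos y ∧ pos y < pos x := by
      intro y hy
      rw [Finset.mem_filter]
      rcases Finset.mem_insert.mp hy with rfl | hy
      · refine ⟨hzH, Nat.pos_of_ne_zero fun h => hwG ?_, hzx⟩
        rwa [hinj hw hzH (hw0.trans h.symm)]
      · exact hB y hy
    have h3 := Finset.card_le_card h2
    rw [Finset.card_insert_of_notMem fun h => hzS (Finset.mem_sdiff.mp h).1, hBc] at h3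
    rw [hentry]
    omega
  · rw [hU, ← Finset.coe_union, Finset.sdiff_union_of_subset hGS]

open Classical in
-- Union bound over `k` and `U`: the remaining `k` elements are chosen among the at most `pos u_s -
-- 1` points strictly between `w` and `u_s`.
theorem card_brokenSets_le {H : Finset (RP n)} {w : RP n} (hw : w ∈ H) {pos : RP n → ℕ}
    (hinj : Set.InjOn pos H) (hw0 : pos w = 0) :
    (brokenSets H w pos).card ≤ ∑ k ∈ Finset.range (n - 1), ∑ U ∈ indepTuplesAvoiding H w (n - k),
      if IsBrokenFlag H w pos U ∧ k + 3 ≤ pos (entryFromEnd w U (n - k)) + 1 then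
        (pos (entryFromEnd w U (n - k)) - 1).choose k else 0 := by
  have hsub : brokenSets H w pos ⊆ (Finset.range (n - 1)).biUnion fun k =>
      (indepTuplesAvoiding H w (n - k)).biUnion fun U =>
        if IsBrokenFlag H w pos U ∧ k + 3 ≤ pos (entryFromEnd w U (n - k)) + 1 then
          ((H.filter fun y => 0 < pos y ∧ pos y < pos (entryFromEnd w U (n - k))).powersetCard
            k).image fun B => B ∪ Finset.univ.image U
        else ∅ := by
    intro S hS
    obtain ⟨k, hk, U, hU, hflag, hle, B, hBc, hB, hSB⟩ := exists_isBrokenFlag hw hinj hw0 hS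
    simp only [Finset.mem_biUnion]
    refine ⟨k, hk, U, hU, ?_⟩
    rw [if_pos ⟨hflag, hle⟩, Finset.mem_image]
    refine ⟨B, Finset.mem_powersetCard.mpr ⟨fun y hy => Finset.mem_filter.mpr (hB y hy), hBc⟩, ?_⟩
    rw [← Finset.coe_inj, hSB]
    simp
  refine (Finset.card_le_card hsub).trans (Finset.card_biUnion_le.trans ?_)
  refine Finset.sum_le_sum fun k _ => Finset.card_biUnion_le.trans (Finset.sum_le_sum fun U _ => ?_)
  split_ifs
  · refine Finset.card_image_le.trans ?_
    rw [Finset.card_powersetCard]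
    exact Nat.choose_le_choose k (card_filter_pos_lt_le hinj _)
  · simp

end ProjArrangement

/-! ### Counting broken flags and averaging over orderings -/

namespace ProjArrangement

variable {n : ℕ}

open Classical in
/-- The position of a point of `H` in an ordering of `H`. -/
noncomputable def orderPos {H : Finset (RP n)} {T : ℕ} (π : H ≃ Fin T) (x : RP n) : ℕ :=
  if h : x ∈ H then π ⟨x, h⟩ else 0

theorem orderPos_coe {H : Finset (RP n)} {T : ℕ} (π : H ≃ Fin T) (x : H) :
    orderPos π x = π x := by
  simp [orderPos]

theorem orderPos_injOn {H : Finset (RP n)} {T : ℕ} (π : H ≃ Fin T) :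
    Set.InjOn (orderPos π) H := by
  intro x hx y hy h
  lift x to H using hx
  lift y to H using hy
  rw [orderPos_coe, orderPos_coe] at h
  rw [π.injective (Fin.ext h)]

section Flag

variable {H : Finset (RP n)} {w : RP n} {s : ℕ} {U : Fin s → RP n}

theorem image_tail_subset_range (l : ℕ) : U '' {j | s ≤ (j : ℕ) + l} ⊆ Set.range U :=
  Set.image_subset_range _ _

theorem entryFromEnd_mem_flagSet (hU : U ∈ indepTuplesAvoiding H w s) {l : ℕ} (hl : 1 ≤ l)
    (hls : l ≤ s) : entryFromEnd w U l ∈ flagSet H U l := by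
  obtain ⟨j, rfl⟩ : ∃ j : Fin s, s - j = l := ⟨⟨s - l, by omega⟩, by simp only; omega⟩
  rw [entryFromEnd_eq, mem_flagSet]
  refine ⟨(mem_indepTuplesAvoiding.mp hU).1 j, submodule_le_linSpan ⟨j, ?_, rfl⟩⟩
  simp only [Set.mem_ofPred_eq]
  omega

theorem entryFromEnd_notMem_flagSet (hU : U ∈ indepTuplesAvoiding H w s) {l : ℕ} (hl : 1 ≤ l)
    (hls : l ≤ s) : entryFromEnd w U l ∉ flagSet H U (l - 1) := by
  classical
  obtain ⟨-, hinj, hrank, -⟩ := mem_indepTuplesAvoiding.mp hU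
  obtain ⟨j, rfl⟩ : ∃ j : Fin s, s - j = l := ⟨⟨s - l, by omega⟩, by simp only; omega⟩
  rw [entryFromEnd_eq, mem_flagSet]
  rintro ⟨-, h⟩
  have hind : Module.finrank ℝ (linSpan ((Finset.univ.image U : Finset (RP n)) : Set (RP n))) =
      (Finset.univ.image U).card := by
    rw [Finset.card_image_of_injective _ hinj, Finset.card_univ, Fintype.card_fin,
      Finset.coe_image, Finset.coe_univ, Set.image_univ, hrank]
  refine not_submodule_le_linSpan_of_notMem hind
    (S' := (Finset.univ.filter fun i : Fin s => s ≤ (i : ℕ) + (s - j - 1)).image U)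
    (Finset.image_subset_image (Finset.filter_subset _ _))
    (Finset.mem_image_of_mem U (Finset.mem_univ j)) ?_ ?_
  · rw [hinj.mem_finset_image, Finset.mem_filter]
    omega
  · convert h using 2
    simp

theorem notMem_flagSet (hU : U ∈ indepTuplesAvoiding H w s) (l : ℕ) : w ∉ flagSet H U l :=
  fun h => (mem_indepTuplesAvoiding.mp hU).2.2.2
    ((mem_flagSet.mp h).2.trans (linSpan_mono (image_tail_subset_range l)))

theorem flagSet_subset (l : ℕ) : flagSet H U l ⊆ H := fun _ hp =>
  (mem_flagSet.mp hp).1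

end Flag

/-- Here `a = q_{s-1}` and `a + m + 1 = q_s`. Both products share the factor `(T - d).descFactorial
a * (T - 2 - a - m)!`; what remains is the bracket of `A_s` times `m!`. If `m > T - a - d`, the
subtracted terms vanish on both sides. -/
theorem brokenFlag_count_eq {T a m d N : ℕ} (had : a + d ≤ T) (ham : a + m + 2 ≤ T)
    (h : N + (T - d).descFactorial (a + m) * (T - 2 - (a + m)).factorial =
      (T - d).descFactorial a * (T - 2 - a).factorial) :
    (N : ℝ) = ((T - d).factorial : ℝ) * ((T - (a + m + 1) - 1).factorial : ℝ) /
        ((T - a - d).factorial : ℝ) *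
      ((((T - a - 2).choose m : ℝ) - ((T - a - d).choose m : ℝ)) * (m.factorial : ℝ)) := by
  have h1 := Nat.factorial_mul_descFactorial (show a ≤ T - d by omega)
  have h2 := Nat.choose_mul_factorial_mul_factorial (show m ≤ T - a - 2 by omega)
  have h3 := Nat.descFactorial_mul_descFactorial (n := T - d) (show a ≤ a + m by omega)
  rw [Nat.add_sub_cancel_left, Nat.descFactorial_eq_factorial_mul_choose] at h3
  rw [show T - d - a = T - a - d by omega] at h1 h3
  rw [show T - a - 2 - m = T - (a + m + 1) - 1 by omega] at h2
  rw [show T - 2 - (a + m) = T - (a + m + 1) - 1 by omega, show T - 2 - a = T - a - 2 by omega,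
    ← h2, ← h3] at h
  have hne : ((T - a - d).factorial : ℝ) ≠ 0 := Nat.cast_ne_zero.mpr (Nat.factorial_ne_zero _)
  have h1' : ((T - d).factorial : ℝ) = (T - a - d).factorial * (T - d).descFactorial a := by
    exact_mod_cast h1.symm
  have h' : (N : ℝ) + m.factorial * (T - a - d).choose m * (T - d).descFactorial a *
      (T - (a + m + 1) - 1).factorial = (T - d).descFactorial a *
        ((T - a - 2).choose m * m.factorial * (T - (a + m + 1) - 1).factorial) := by
    exact_mod_cast h
  rw [h1', eq_sub_of_add_eq h']
  field_simp

open Classical in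
/-- The number of orderings of `H` beginning with `w` for which the flag of `U` is broken and `u_s`
is in position `d`, positions being counted from `1`. -/
theorem card_brokenFlag_orderings {H : Finset (RP n)} {T : ℕ} (hT : H.card = T) {w : RP n}
    (hw : w ∈ H) {s : ℕ} (hs : 1 ≤ s) {U : Fin s → RP n} (hU : U ∈ indepTuplesAvoiding H w s) {d : ℕ}
    (hd : 2 ≤ d) (hdT : d ≤ T - flagCount H U (s - 1)) :
    ((Finset.univ.filter fun π : H ≃ Fin T => orderPos π w = 0 ∧
        orderPos π (entryFromEnd w U s) + 1 = d ∧ IsBrokenFlag H w (orderPos π) U).card : ℝ) =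
      1 / (∏ l ∈ Finset.Icc 1 (s - 1), (flagCount H U l : ℝ)) *
        (((T - d).factorial : ℝ) * ((T - flagCount H U s - 1).factorial : ℝ) /
          ((T - flagCount H U (s - 1) - d).factorial : ℝ) * coeffA H U d) := by
  have hT' : Fintype.card H = T := by rw [Fintype.card_coe, hT]
  have hex : ∀ l, ∃ a : H, l ∈ Finset.Icc 1 s → (a : RP n) = entryFromEnd w U l := by
    intro l
    by_cases hl : l ∈ Finset.Icc 1 s
    · rw [Finset.mem_Icc] at hl
      exact ⟨⟨_, flagSet_subset l (entryFromEnd_mem_flagSet hU hl.1 hl.2)⟩, fun _ => rfl⟩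
    · exact ⟨⟨w, hw⟩, fun h => absurd h hl⟩
  choose u hu using hex
  let Y : ℕ → Finset H := fun l => (flagSet H U l).subtype (· ∈ H)
  have hY : ∀ l (z : H), z ∈ Y l ↔ (z : RP n) ∈ flagSet H U l := fun l z => Finset.mem_subtype
  have hYc : ∀ l, (Y l).card = flagCount H U l := by
    intro l
    rw [Finset.card_subtype, Finset.filter_true_of_mem fun x hx => flagSet_subset l hx, card_flagSet]
  have hYmono : Monotone Y := fun l l' hl z hz =>
    (hY l' z).mpr (flagSet_mono H U hl ((hY l z).mp hz))
  have hforall : ∀ l (Q : RP n → Prop), (∀ z ∈ flagSet H U l, Q z) ↔ ∀ z ∈ Y l, Q (z : RP n) :=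
    fun l Q => ⟨fun h z hz => h z ((hY l z).mp hz), fun h z hz =>
      h ⟨z, flagSet_subset l hz⟩ ((hY l _).mpr hz)⟩
  have huY : ∀ l ∈ Finset.Icc 1 s, u l ∈ Y l := fun l hl => by
    rw [hY, hu l hl]
    exact entryFromEnd_mem_flagSet hU (Finset.mem_Icc.mp hl).1 (Finset.mem_Icc.mp hl).2
  have huY' : ∀ l ∈ Finset.Icc 1 s, u l ∉ Y (l - 1) := fun l hl => by
    rw [hY, hu l hl]
    exact entryFromEnd_notMem_flagSet hU (Finset.mem_Icc.mp hl).1 (Finset.mem_Icc.mp hl).2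
  let w' : H := ⟨w, hw⟩
  have hwY : ∀ l, w' ∉ Y l := fun l h => notMem_flagSet hU l ((hY l _).mp h)
  have hsmem : s ∈ Finset.Icc 1 s := Finset.mem_Icc.mpr ⟨hs, le_rfl⟩
  have hwu : w' ≠ u s := fun h => hwY s (h ▸ huY s hsmem)
  have hdT' : d ≤ T := hdT.trans (Nat.sub_le _ _)
  let p : Fin T := ⟨0, by omega⟩
  -- Elements of `Fin T` count positions from `0`, while `d` counts from `1`.
  let q : Fin T := ⟨d - 1, by omega⟩
  have hpq : p < q := Fin.lt_def.mpr (by simp only [p, q]; omega)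
  have hYs : Y (s - 1) ⊆ (Y s).erase (u s) := fun z hz => Finset.mem_erase.mpr
    ⟨fun h => huY' s hsmem (h ▸ hz), hYmono (Nat.sub_le s 1) hz⟩
  have hlt : flagCount H U (s - 1) + 1 ≤ flagCount H U s := by
    have h1 := Finset.card_le_card hYs
    have h2 := Finset.card_pos.mpr ⟨_, huY s hsmem⟩
    rw [Finset.card_erase_of_mem (huY s hsmem), hYc, hYc] at h1
    rw [hYc] at h2
    omega
  have hltT : flagCount H U s + 1 ≤ T := by
    rw [← hT, ← card_flagSet, ← Finset.card_insert_of_notMem (notMem_flagSet hU s)]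
    exact Finset.card_le_card (Finset.insert_subset_iff.mpr ⟨hw, flagSet_subset s⟩)
  set after : Finset (H ≃ Fin T) := Finset.univ.filter fun π : H ≃ Fin T =>
    (π w' = p ∧ π (u s) = q) ∧ ∀ z ∈ Y (s - 1), q < π z with hafter
  set broken := after.filter fun π => ∃ z ∈ Y s, π z < q with hbroken
  -- Complementary counting: among the orderings with `Y (s - 1)` after `u s`, the unbroken ones
  -- have all of `Y s` except `u s` after it.
  have hcount : broken.card + (T - d).descFactorial (flagCount H U s - 1) *
      (T - 2 - (flagCount H U s - 1)).factorial =
      (T - d).descFactorial (flagCount H U (s - 1)) *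
        (T - 2 - flagCount H U (s - 1)).factorial := by
    have h1 := OrderingCount.card_filter_after hT' hwu hpq (Y (s - 1)) (hwY _) (huY' s hsmem)
    have h2 := OrderingCount.card_filter_after hT' hwu hpq ((Y s).erase (u s))
      (fun h => hwY s (Finset.mem_of_mem_erase h)) (Finset.notMem_erase _ _)
    rw [Finset.card_erase_of_mem (huY s hsmem), hYc] at h2
    rw [hYc] at h1
    have hq : T - 1 - (q : ℕ) = T - d := by simp only [q]; omega
    rw [hq] at h1 h2
    rw [← h1, ← h2, ← Finset.card_filter_add_card_filter_not (s := after)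
      (fun π => ∃ z ∈ Y s, π z < q)]
    congr 2
    ext π
    simp only [hafter, Finset.mem_filter, Finset.mem_univ, true_and, not_exists, not_and, not_lt]
    constructor
    · rintro ⟨h1, h2⟩
      refine ⟨⟨h1, fun z hz => h2 z (hYs hz)⟩, fun z hz => ?_⟩
      rcases eq_or_ne z (u s) with rfl | hne
      · exact h1.2.ge
      · exact (h2 z (Finset.mem_erase.mpr ⟨hne, hz⟩)).le
    · rintro ⟨⟨h1, -⟩, h3⟩
      refine ⟨h1, fun z hz => ?_⟩
      obtain ⟨hne, hz⟩ := Finset.mem_erase.mp hz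
      refine lt_of_le_of_ne (h3 z hz) fun h => hne (π.injective ?_)
      rw [← h, h1.2]
  -- The conditions at step `s` are symmetric in `Y (s - 1)`, so the lower steps contribute the
  -- independent factor `∏ 1 / q_l`.
  have hinv : ∀ a ∈ Y (s - 1), ∀ b ∈ Y (s - 1), ∀ π ∈ broken, (Equiv.swap a b).trans π ∈ broken := by
    intro a ha b hb π hπ
    simp only [hbroken, hafter, Finset.mem_filter, Finset.mem_univ, true_and] at hπ ⊢
    obtain ⟨⟨⟨h1, h2⟩, h3⟩, z, hz, hzq⟩ := hπ
    have hswap : ∀ l, s - 1 ≤ l → ∀ z ∈ Y l, Equiv.swap a b z ∈ Y l := by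
      intro l hl z hz
      rw [Equiv.swap_apply_def]
      split_ifs
      · exact hYmono hl hb
      · exact hYmono hl ha
      · exact hz
    have hne : ∀ c, c ∉ Y (s - 1) → Equiv.swap a b c = c := fun c hc =>
      Equiv.swap_apply_of_ne_of_ne (fun h : c = a => hc (h ▸ ha)) (fun h : c = b => hc (h ▸ hb))
    refine ⟨⟨⟨?_, ?_⟩, fun z hz => h3 _ (hswap _ le_rfl z hz)⟩, Equiv.swap a b z,
      hswap s (Nat.sub_le s 1) z hz, ?_⟩
    · rw [Equiv.trans_apply, hne _ (hwY _), h1]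
    · rw [Equiv.trans_apply, hne _ (huY' s hsmem), h2]
    · rwa [Equiv.trans_apply, Equiv.swap_apply_self]
  have hflag := OrderingCount.card_filter_flag_mul_prod (P := broken) Y u (s - 1) hYmono
    (fun l hl => huY l (Finset.Icc_subset_Icc le_rfl (Nat.sub_le s 1) hl))
    (fun l hl => huY' l (Finset.Icc_subset_Icc le_rfl (Nat.sub_le s 1) hl)) hinv
  have hset : (Finset.univ.filter fun π : H ≃ Fin T => orderPos π w = 0 ∧
      orderPos π (entryFromEnd w U s) + 1 = d ∧ IsBrokenFlag H w (orderPos π) U) =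
      broken.filter fun π => ∀ l ∈ Finset.Icc 1 (s - 1), ∀ z ∈ Y l, π (u l) ≤ π z := by
    ext π
    have e1 : orderPos π w = 0 ↔ π w' = p := by
      rw [Fin.ext_iff, ← orderPos_coe]
    have e2 : orderPos π (entryFromEnd w U s) + 1 = d ↔ π (u s) = q := by
      rw [← hu s hsmem, orderPos_coe, Fin.ext_iff]
      simp only [q]
      omega
    have e3 : (∀ l ∈ Finset.Icc 1 (s - 1), ∀ z ∈ flagSet H U l,
        orderPos π (entryFromEnd w U l) ≤ orderPos π z) ↔
        ∀ l ∈ Finset.Icc 1 (s - 1), ∀ z ∈ Y l, π (u l) ≤ π z := by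
      refine forall₂_congr fun l hl => ?_
      rw [hforall l]
      refine forall₂_congr fun z _ => ?_
      rw [← hu l (Finset.Icc_subset_Icc le_rfl (Nat.sub_le s 1) hl), orderPos_coe, orderPos_coe,
        Fin.le_def]
    have e4 : π (u s) = q → ((∀ z ∈ flagSet H U (s - 1),
        orderPos π (entryFromEnd w U s) < orderPos π z) ↔ ∀ z ∈ Y (s - 1), q < π z) := by
      intro h
      rw [hforall]
      refine forall₂_congr fun z _ => ?_
      rw [← hu s hsmem, orderPos_coe, orderPos_coe, ← Fin.lt_def, h]
    have e5 : π (u s) = q → ((∃ z ∈ flagSet H U s,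
        orderPos π z < orderPos π (entryFromEnd w U s)) ↔ ∃ z ∈ Y s, π z < q) := by
      intro h
      rw [← not_iff_not]
      push Not
      rw [hforall]
      refine forall₂_congr fun z _ => ?_
      rw [← hu s hsmem, orderPos_coe, orderPos_coe, ← Fin.le_def, h]
    simp only [hbroken, hafter, Finset.mem_filter, Finset.mem_univ, true_and, e1, e2]
    constructor
    · rintro ⟨h1, h2, ⟨h3, h4⟩, h5⟩
      exact ⟨⟨⟨⟨h1, h2⟩, (e4 h2).mp h3⟩, (e5 h2).mp h4⟩, e3.mp h5⟩
    · rintro ⟨⟨⟨⟨h1, h2⟩, h3⟩, h4⟩, h5⟩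
      exact ⟨h1, h2, ⟨(e4 h2).mpr h3, (e5 h2).mpr h4⟩, e3.mpr h5⟩
  obtain ⟨m, hm⟩ : ∃ m, flagCount H U s = flagCount H U (s - 1) + m + 1 :=
    ⟨flagCount H U s - flagCount H U (s - 1) - 1, by omega⟩
  have hformula := brokenFlag_count_eq (T := T) (a := flagCount H U (s - 1)) (m := m) (d := d)
    (N := broken.card) (by omega) (by omega) (by rwa [hm, Nat.add_sub_cancel] at hcount)
  have hne : (∏ l ∈ Finset.Icc 1 (s - 1), (flagCount H U l : ℝ)) ≠ 0 := by
    refine Finset.prod_ne_zero_iff.mpr fun l hl => Nat.cast_ne_zero.mpr ?_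
    rw [← hYc]
    exact (Finset.card_pos.mpr
      ⟨_, huY l (Finset.Icc_subset_Icc le_rfl (Nat.sub_le s 1) hl)⟩).ne'
  have hA : coeffA H U d = (((T - flagCount H U (s - 1) - 2).choose m : ℝ) -
      ((T - flagCount H U (s - 1) - d).choose m : ℝ)) * (m.factorial : ℝ) := by
    rw [coeffA, hT, show flagCount H U s - flagCount H U (s - 1) - 1 = m by omega]
  rw [hset, hA, hm, ← hformula, ← hflag, one_div, eq_inv_mul_iff_mul_eq₀ hne]
  push_cast
  simp only [hYc]
  ring_nf

open Classical in
-- The orderings are grouped by the position `d` of `u_s`, on which the weight depends only through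
-- `choose (d - 2) k`.
theorem sum_brokenFlag_eq {H : Finset (RP n)} {T : ℕ} (hT : H.card = T) {w : RP n}
    (hw : w ∈ H) {s k : ℕ} (hs : 1 ≤ s) {U : Fin s → RP n} (hU : U ∈ indepTuplesAvoiding H w s) :
    ((∑ π ∈ Finset.univ.filter (fun π : H ≃ Fin T => orderPos π w = 0),
      if IsBrokenFlag H w (orderPos π) U ∧ k + 3 ≤ orderPos π (entryFromEnd w U s) + 1 then
        (orderPos π (entryFromEnd w U s) - 1).choose k else 0 : ℕ) : ℝ) =
      1 / (∏ l ∈ Finset.Icc 1 (s - 1), (flagCount H U l : ℝ)) *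
        ∑ d ∈ Finset.Icc (k + 3) (T - flagCount H U (s - 1)),
          ((T - d).factorial : ℝ) * ((T - flagCount H U s - 1).factorial : ℝ) /
            ((T - flagCount H U (s - 1) - d).factorial : ℝ) * coeffA H U d *
            ((d - 2).choose k : ℝ) := by
  rw [← Finset.sum_filter, Finset.filter_filter, ← Finset.sum_fiberwise_of_maps_to
    (g := fun π : H ≃ Fin T => orderPos π (entryFromEnd w U s) + 1)
    (t := Finset.Icc (k + 3) (T - flagCount H U (s - 1))), Nat.cast_sum, Finset.mul_sum]
  · refine Finset.sum_congr rfl fun d hd => ?_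
    rw [Finset.mem_Icc] at hd
    rw [← mul_assoc, ← card_brokenFlag_orderings hT hw hs hU (by omega) hd.2, Finset.filter_filter]
    have hset : (Finset.univ.filter fun π : H ≃ Fin T => (orderPos π w = 0 ∧
        IsBrokenFlag H w (orderPos π) U ∧ k + 3 ≤ orderPos π (entryFromEnd w U s) + 1) ∧
        orderPos π (entryFromEnd w U s) + 1 = d) = Finset.univ.filter fun π : H ≃ Fin T =>
        orderPos π w = 0 ∧ orderPos π (entryFromEnd w U s) + 1 = d ∧
          IsBrokenFlag H w (orderPos π) U := by
      refine Finset.filter_congr fun π _ => ?_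
      constructor
      · tauto
      · rintro ⟨h1, h2, h3⟩
        exact ⟨⟨h1, h3, by omega⟩, h2⟩
    rw [hset, ← Nat.cast_mul, Finset.sum_congr rfl (g := fun _ => (d - 2).choose k),
      Finset.sum_const, smul_eq_mul]
    intro π hπ
    have := (Finset.mem_filter.mp hπ).2.2.1
    rw [show orderPos π (entryFromEnd w U s) - 1 = d - 2 by omega]
  · intro π hπ
    obtain ⟨-, -, ⟨⟨hafter, -⟩, -⟩, hle⟩ := Finset.mem_filter.mp hπ
    refine Finset.mem_Icc.mpr ⟨hle, ?_⟩
    -- All `q_{s-1}` points of the previous flag step come after `u_s`, which forces `d ≤ T -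
    -- q_{s-1}`.
    have hcard : flagCount H U (s - 1) ≤
        (Finset.Ioo (orderPos π (entryFromEnd w U s)) T).card := by
      rw [← card_flagSet]
      refine Finset.card_le_card_of_injOn (orderPos π) ?_
        ((orderPos_injOn π).mono (Finset.coe_subset.mpr (flagSet_subset _)))
      intro z hz
      refine Finset.mem_coe.mpr (Finset.mem_Ioo.mpr ⟨hafter z hz, ?_⟩)
      have := orderPos_coe π ⟨z, flagSet_subset _ hz⟩
      simp only at this
      rw [this]
      exact Fin.is_lt _
    have hlt : orderPos π (entryFromEnd w U s) < T := by
      have := orderPos_coe π ⟨_, flagSet_subset _ (entryFromEnd_mem_flagSet hU hs le_rfl)⟩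
      simp only at this
      rw [this]
      exact Fin.is_lt _
    rw [Nat.card_Ioo] at hcard
    omega

open Classical in
/-- A bound through every ordering of `H` gives a bound through the average over the orderings. -/
theorem le_average_of_forall_le {H : Finset (RP n)} {T : ℕ} (hT : H.card = T) {w : RP n}
    (hw : w ∈ H) {R D : ℕ}
    (hR : ∀ pos : RP n → ℕ, Set.InjOn pos H → R ≤ D + (brokenSets H w pos).card) :
    (R : ℝ) ≤
      1 / ((T - 1).factorial : ℝ) *
        ∑ k ∈ Finset.range (n - 1),
          ∑ U ∈ indepTuplesAvoiding H w (n - k),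
            1 / (∏ l ∈ Finset.Icc 1 (n - k - 1), (flagCount H U l : ℝ)) *
              ∑ d ∈ Finset.Icc (k + 3) (T - flagCount H U (n - k - 1)),
                ((T - d).factorial : ℝ) *
                    ((T - flagCount H U (n - k) - 1).factorial : ℝ) /
                    ((T - flagCount H U (n - k - 1) - d).factorial : ℝ) *
                  coeffA H U d * ((d - 2).choose k : ℝ)
        + (D : ℝ) := by
  have hpos : 0 < T := hT ▸ Finset.card_pos.mpr ⟨w, hw⟩
  set orderings := Finset.univ.filter fun π : H ≃ Fin T => orderPos π w = 0
  have hcard : orderings.card = (T - 1).factorial := by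
    rw [← OrderingCount.card_filter_apply_eq (by rw [Fintype.card_coe, hT]) (⟨w, hw⟩ : H)
      (⟨0, hpos⟩ : Fin T)]
    congr 1
    refine Finset.filter_congr fun π _ => ?_
    rw [Fin.ext_iff, ← orderPos_coe]
  have hle : ∀ π ∈ orderings, R ≤ D + (brokenSets H w (orderPos π)).card := fun π _ =>
    hR _ (orderPos_injOn π)
  -- Sum over the orderings beginning with `w`; exchanging sums then isolates each tuple `U`.
  have hsum := (Finset.sum_le_sum hle).trans (Finset.sum_le_sum fun π hπ => Nat.add_le_add_left
    (card_brokenSets_le hw (orderPos_injOn π) (Finset.mem_filter.mp hπ).2) _)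
  rw [Finset.sum_const, smul_eq_mul, Finset.sum_add_distrib, Finset.sum_const, smul_eq_mul, hcard,
    Finset.sum_comm, Finset.sum_congr rfl fun k _ => Finset.sum_comm] at hsum
  have hsum' := (Nat.cast_le (α := ℝ)).mpr hsum
  rw [Nat.cast_mul, Nat.cast_add, Nat.cast_mul, Nat.cast_sum] at hsum'
  have hfac : (0 : ℝ) < (T - 1).factorial := Nat.cast_pos.mpr (Nat.factorial_pos _)
  rw [one_div, ← sub_le_iff_le_add, le_inv_mul_iff₀ hfac, mul_sub, sub_le_iff_le_add, add_comm]
  refine hsum'.trans_eq (congrArg _ (Finset.sum_congr rfl fun k hk => ?_))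
  rw [Nat.cast_sum]
  refine Finset.sum_congr rfl fun U hU => ?_
  exact sum_brokenFlag_eq hT hw (by have := Finset.mem_range.mp hk; omega) hU

end ProjArrangement

theorem theorem4 {F : Type*} [Field F] (n : ℕ) [LinearOrder (ProjArrangement.RP n)]
    (H : Finset (ProjArrangement.RP n)) (T : ℕ) (hT : H.card = T)
    (w : ProjArrangement.RP n) (hw : w ∈ H) :
    (Module.finrank F (SimplicialHomology.RelHomology F (ProjArrangement.KComplex H)
        (SimplicialHomology.skeletonLT (ProjArrangement.KComplex H) n) n) : ℝ) ≤
      1 / ((T - 1).factorial : ℝ) *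
        ∑ k ∈ Finset.range (n - 1),
          ∑ U ∈ ProjArrangement.indepTuplesAvoiding H w (n - k),
            1 / (∏ l ∈ Finset.Icc 1 (n - k - 1), (ProjArrangement.flagCount H U l : ℝ)) *
              ∑ d ∈ Finset.Icc (k + 3) (T - ProjArrangement.flagCount H U (n - k - 1)),
                ((T - d).factorial : ℝ) *
                    ((T - ProjArrangement.flagCount H U (n - k) - 1).factorial : ℝ) /
                    ((T - ProjArrangement.flagCount H U (n - k - 1) - d).factorial : ℝ) *
                  ProjArrangement.coeffA H U d * ((d - 2).choose k : ℝ)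
        + (ProjArrangement.numDependent H w : ℝ) := by
  exact ProjArrangement.le_average_of_forall_le hT hw fun _ hinj =>
    ProjArrangement.finrank_relHomology_le hw hinj
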